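/- **Setting.** A network is a directed graph of channels on a set of processes; each channel $i\to j$ carries an integer bound $b_{ij}\ge 1$. Time is discrete ($0,1,2,\dots$), and the local state of a process contains the current global time. A deterministic protocol $P$ prescribes the possible initial states, how each local state is computed from the previous local state of the same process and from the messages and external inputs just received, and, for each local state, the actions performed and the message (if any) sent to each neighbour. The system $\mathcal R=\mathcal R(P,\gamma^{\max})$ consists of all runs $r$ of $P$ in which a message sent at time $s$ over $i\to j$ is received at some time in $\{s+1,\dots,s+b_{ij}\}$ and external inputs arrive spontaneously, each external input arriving at a given process at most once. Write $r_i(t)$ for the local state of $i$ at time $t$ in $r$. **Causal relations.** Let $\mathsf D(i,j)\in\mathbb N\cup\{\infty\}$ be the minimal weight of a directed path from $i$ to $j$, channels being weighted by their bounds, and write $(i,t)\dashrightarrow(j,t')$ iff $t+\mathsf D(i,j)\le t'$. In a run $r$, syncausality $\rightsquigarrow$ is the smallest transitive relation on process-time nodes such that: $(i,t)\rightsquigarrow(i,t')$ if $t\le t'$; $(i,t)\rightsquigarrow(j,t')$ if some message is sent at $(i,t)$ and received at $(j,t')$; and $(i,t)\rightsquigarrow(j,t+b_{ij})$ if $i\to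 j$ is a channel over which no message is sent at $(i,t)$. For $t\le t'$, a centipede for $\langle i_0,\dots,i_k\rangle$ in $(r,t..t')$ is a sequence of nodes $\theta_0\rightsquigarrow\theta_1\rightsquigarrow\cdots\rightsquigarrow\theta_k$ with $\theta_0=(i_0,t)$, $\theta_k=(i_k,t')$ and $\theta_h\dashrightarrow(i_h,t')$ for $0<h<k$. **Knowledge.** $(\mathcal R,r,t)\models K_i\varphi$ iff $(\mathcal R,r',t'')\models\varphi$ for all $r'\in\mathcal R$ and all $t''$ with $r'_i(t'')=r_i(t)$. $(\mathcal R,r,t)\models \mathrm{occurred}(e)$ iff $e$ occurs in $r$ at some time $\le t$. **Ordered Response.** An instance $\mathsf{OR}=\langle e_{\mathtt t},\alpha_1,\dots,\alpha_k\rangle$ consists of an external input $e_{\mathtt t}$ to a process $i_0$ and, for $h=1,\dots,k$, a response $\alpha_h$, which is an action $a_h$ of a process $i_h$. The protocol $P$ *solves* $\mathsf{OR}$ if in every run of $\mathcal R$: each $\alpha_h$ is performed iff $e_{\mathtt t}$ occurs; each $\alpha_h$ is performed at most once; and, for $h<k$, $\alpha_h$ is performed no later than $\alpha_{h+1}$.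 The protocol $P$ is *non-hesitant* for $\mathsf{OR}$ if in every run of $\mathcal R$, for each $h=1,\dots,k$, $\alpha_h$ is performed exactly at the first time (if any) at which $K_{i_h}K_{i_{h-1}}\cdots K_{i_1}\,\mathrm{occurred}(e_{\mathtt t})$ holds. The protocol $P$ is a *full-information protocol* if, in all its runs, every process sends its local state (under an injective encoding) on each of its outgoing channels at every time step, and its local state retains its entire local history: its initial state, and the external inputs and messages received, the actions performed and the messages sent so far, with their times. **Theorem (Nested Knowledge Sufficiency).** Let $P$ be a full-information protocol that is non-hesitant for $\mathsf{OR}=\langle e_{\mathtt t},\alpha_1,\dots,\alpha_k\rangle$. Suppose that for every run $r\in\mathcal R(P,\gamma^{\max})$ and every time $t$ such that $e_{\mathtt t}$ occurs at $(i_0,t)$ in $r$, there is a time $t'$ for which a centipede for $\langle i_0,\dots,i_k\rangle$ in $(r,t..t')$ exists. Then $P$ solves $\mathsf{OR}$. -/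

import Mathlib

namespace SyncNet

/-- A communication network: a directed graph of channels, each with an upper bound (a positive
number of time steps) on the transmission time of messages sent over it. -/
structure Network (Proc : Type*) where
  Chan : Proc → Proc → Prop
  bound : Proc → Proc → ℕ
  bound_pos : ∀ i j, Chan i j → 1 ≤ bound i j

/-- A process-time node `(i, t)`. -/
abbrev Node (Proc : Type*) := Proc × ℕ

/-- `N.Path i j w`: there is a directed path from `i` to `j` of total weight `w`, where the weight
of a channel is its bound. -/
inductive Network.Path {Proc : Type*} (N : Network Proc) : Proc → Proc → ℕ → Prop
  | nil (i : Proc) : Network.Path N i i 0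
  | cons {i j l : Proc} {w : ℕ} :
      N.Chan i j → Network.Path N j l w → Network.Path N i l (N.bound i j + w)

/-- The transmission distance `D(i, j)`: the minimal weight of a path from `i` to `j`
(`⊤` if there is none). -/
noncomputable def Network.dist {Proc : Type*} (N : Network Proc) (i j : Proc) : ℕ∞ :=
  ⨅ (w : ℕ) (_ : N.Path i j w), (w : ℕ∞)

/-- The bound guarantee relation: `(i, t) ⇢ (j, t')` iff `t + D(i, j) ≤ t'`. -/
def Network.Guarantee {Proc : Type*} (N : Network Proc) (a b : Node Proc) : Prop :=
  (a.2 : ℕ∞) + N.dist a.1 b.1 ≤ (b.2 : ℕ∞)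

/-- A deterministic protocol for the processes of a synchronous network. The local state of `i` at
time `t` is the pair `(t, m)` of the global clock value and the memory content `m : Mem i`.
* `init` is the set of possible initial memory contents of all the processes;
* `start` incorporates the external inputs of time `0`, and `next` computes the memory content at
  time `t + 1` from the local state at time `t` and from the messages (listed by sender) and the
  external inputs received at time `t + 1`;
* `send i s j` is the message (if any) that `i` sends to its neighbour `j` in local state `s`;
* `act i s` is the set of actions that `i` performs in local state `s`. -/
structure Protocol (Proc Input Act : Type*) where
  Msg : Type*
  Mem : Proc → Type*
  init : Set (∀ i, Mem i)
  start : ∀ i, Mem i → Finset Input → Mem i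
  next : ∀ i, ℕ × Mem i → (Proc → Multiset Msg) → Finset Input → Mem i
  send : ∀ i, ℕ × Mem i → Proc → Option Msg
  act : ∀ i, ℕ × Mem i → Set Act

/-- The data of an execution: initial memory contents, memory contents at all times, external
inputs arriving at each node, and the time `delivery i j s` at which a message sent by `i` to `j`
at time `s` (if there is one) is received. -/
structure Execution {Proc Input Act : Type*} (P : Protocol Proc Input Act) where
  init : ∀ i, P.Mem i
  mem : ∀ i, ℕ → P.Mem i
  inputs : Proc → ℕ → Finset Input
  delivery : Proc → Proc → ℕ → ℕ

section Execution

variable {Proc Input Act : Type*} {P : Protocol Proc Input Act}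

/-- The local state of `i` at time `t`, of which the time `t` is a component. -/
def Execution.localState (r : Execution P) (i : Proc) (t : ℕ) : ℕ × P.Mem i := (t, r.mem i t)

/-- The message, if any, that is sent by `i` to `j` at time `s`. -/
noncomputable def Execution.sent (N : Network Proc) (r : Execution P) (i j : Proc) (s : ℕ) :
    Option P.Msg :=
  open Classical in if N.Chan i j then P.send i (r.localState i s) j else none

/-- The messages that `j` receives at time `t`, listed by sender. -/
noncomputable def Execution.received (N : Network Proc) (r : Execution P) (j : Proc) (t : ℕ) :
    Proc → Multiset P.Msg :=
  fun i => ((Finset.range t).filter (fun s => r.delivery i j s = t)).val.filterMap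
    (fun s => r.sent N i j s)

end Execution

/-- The runs of the protocol `P` in the synchronous context given by the network `N`, i.e. the
system `R(P, γ^max)`: all executions that follow the protocol, in which every message is delivered
at least one time step after it is sent and within the bound of its channel, and in which the
environment spontaneously supplies external inputs. Events in a run are distinct: a given external
input arrives at a given process at most once. -/
structure Run {Proc Input Act : Type*} (N : Network Proc) (P : Protocol Proc Input Act)
    extends Execution P where
  init_mem : init ∈ P.init
  inputs_distinct : ∀ i x t t', x ∈ inputs i t → x ∈ inputs i t' → t = t'
  delivery_gt : ∀ i j s, N.Chan i j → s + 1 ≤ delivery i j s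
  delivery_le : ∀ i j s, N.Chan i j → delivery i j s ≤ s + N.bound i j
  mem_zero : ∀ i, mem i 0 = P.start i (init i) (inputs i 0)
  mem_succ : ∀ i t, mem i (t + 1) =
    P.next i (toExecution.localState i t) (toExecution.received N i (t + 1)) (inputs i (t + 1))

section Runs

variable {Proc Input Act : Type*} {N : Network Proc} {P : Protocol Proc Input Act}

/-- The external input `x` to process `i` occurs at `(i, t)` in `r`. -/
def Run.Occurs (r : Run N P) (i : Proc) (x : Input) (t : ℕ) : Prop := x ∈ r.inputs i t

/-- The set of actions performed by `i` at time `t` in `r`. -/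
def Run.performed (r : Run N P) (i : Proc) (t : ℕ) : Set Act := P.act i (r.localState i t)

/-- The syncausality relation `⇝` over the nodes of the run `r`. -/
inductive Run.Syncausal (r : Run N P) : Node Proc → Node Proc → Prop
  | local_prec {i : Proc} {t t' : ℕ} : t ≤ t' → Run.Syncausal r (i, t) (i, t')
  | message {i j : Proc} {t : ℕ} : (r.sent N i j t).isSome →
      Run.Syncausal r (i, t) (j, r.delivery i j t)
  | timeout {i j : Proc} {t : ℕ} : N.Chan i j → r.sent N i j t = none →
      Run.Syncausal r (i, t) (j, t + N.bound i j)
  | trans {a b c : Node Proc} : Run.Syncausal r a b → Run.Syncausal r b c → Run.Syncausal r a c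

/-- `θ` is a centipede for `⟨site 0, …, site k⟩` in the interval `(r, t..t')`. -/
structure Run.IsCentipede (r : Run N P) {k : ℕ} (site : Fin (k + 1) → Proc) (t t' : ℕ)
    (θ : Fin (k + 1) → Node Proc) : Prop where
  le : t ≤ t'
  first : θ 0 = (site 0, t)
  last : θ (Fin.last k) = (site (Fin.last k), t')
  body : ∀ h : Fin k, r.Syncausal (θ h.castSucc) (θ h.succ)
  legs : ∀ h : Fin (k + 1), h ≠ 0 → h ≠ Fin.last k → N.Guarantee (θ h) (site h, t')

/-- The local history of `i` up to time `t`: its initial memory content; the messages and the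
external inputs received at each time `s ≤ t`; and the actions performed and messages sent at each
time `s < t` (those of time `t` are a response to the local state at time `t`). -/
noncomputable def Run.history (r : Run N P) (i : Proc) (t : ℕ) :
    P.Mem i × List (ℕ × (Proc → Multiset P.Msg) × Finset Input) ×
      List (ℕ × Set Act × (Proc → Option P.Msg)) :=
  (r.init i,
    (List.range (t + 1)).map (fun s => (s, r.received N i s, r.inputs i s)),
    (List.range t).map (fun s => (s, r.performed i s, fun j => r.sent N i j s)))

/-- Facts about points `(r, t)` of the system of runs of `P`. -/
abbrev Fact {Proc Input Act : Type*} (N : Network Proc) (P : Protocol Proc Input Act) :=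
  Run N P → ℕ → Prop

/-- `(R, r, t) ⊨ K_i φ`: the fact `φ` holds at all points of the system at which `i` has the same
local state as at `(r, t)`. -/
def Knows (i : Proc) (φ : Fact N P) : Fact N P :=
  fun r t => ∀ (r' : Run N P) (t' : ℕ), r'.localState i t' = r.localState i t → φ r' t'

/-- The external input `x` to `i` has occurred by now. -/
def Occurred (i : Proc) (x : Input) : Fact N P := fun r t => ∃ s ≤ t, r.Occurs i x s

end Runs

/-- `P` is a full-information protocol in the network `N`: at every time step every process sends
its local state (injectively encoded as a message) on each of its outgoing channels, and its local
state retains its complete local history (which can be read off the local state). -/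
def FullInformation {Proc Input Act : Type*} (N : Network Proc) (P : Protocol Proc Input Act) :
    Prop :=
  (∃ enc : ∀ i, ℕ × P.Mem i → P.Msg, (∀ i, Function.Injective (enc i)) ∧
    ∀ (r : Run N P) (i j : Proc) (t : ℕ), N.Chan i j →
      r.sent N i j t = some (enc i (r.localState i t))) ∧
  ∀ i, ∃ readHistory : ℕ × P.Mem i → P.Mem i ×
      List (ℕ × (Proc → Multiset P.Msg) × Finset Input) ×
      List (ℕ × Set Act × (Proc → Option P.Msg)),
    ∀ (r : Run N P) (t : ℕ), readHistory (r.localState i t) = r.history i t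

/-- An instance `OR⟨e, α_1, …, α_k⟩` of Ordered Response. The trigger `e` is the external input
`trigger` to process `site 0`; for `h = 1, …, k` the response `α_h` is the action `action (h-1)` of
process `site h` (so a response index is an `h : Fin k`, standing for `α_{h+1}`). -/
structure OrderedResponse (Proc Input Act : Type*) where
  k : ℕ
  site : Fin (k + 1) → Proc
  trigger : Input
  action : Fin k → Act

section OrderedResponse

variable {Proc Input Act : Type*}

/-- The trigger occurs (at process `site 0`) at time `t` in the run `r`. -/
def OrderedResponse.Triggered (O : OrderedResponse Proc Input Act) {N : Network Proc}
    {P : Protocol Proc Input Act} (r : Run N P) (t : ℕ) : Prop :=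
  r.Occurs (O.site 0) O.trigger t

/-- The response with index `h` is performed at time `t` in the run `r`. -/
def OrderedResponse.Responds (O : OrderedResponse Proc Input Act) {N : Network Proc}
    {P : Protocol Proc Input Act} (r : Run N P) (h : Fin O.k) (t : ℕ) : Prop :=
  O.action h ∈ r.performed (O.site h.succ) t

/-- The fact `K_{i_h} K_{i_{h-1}} ⋯ K_{i_1} occurred(e)` (for `h = 0` it is `occurred(e)`). -/
def OrderedResponse.nestedKnowledge (O : OrderedResponse Proc Input Act) (N : Network Proc)
    (P : Protocol Proc Input Act) : Fin (O.k + 1) → Fact N P :=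
  Fin.induction (motive := fun _ => Fact N P) (Occurred (O.site 0) O.trigger)
    (fun h φ => Knows (O.site h.succ) φ)

/-- `P` is non-hesitant for `O`: in every run, each response `α_h` is performed precisely at the
first time, if any, at which `K_{i_h} K_{i_{h-1}} ⋯ K_{i_1} occurred(e)` holds. -/
def OrderedResponse.NonHesitant (O : OrderedResponse Proc Input Act) (N : Network Proc)
    (P : Protocol Proc Input Act) : Prop :=
  ∀ (r : Run N P) (h : Fin O.k) (t : ℕ),
    O.Responds r h t ↔ IsLeast {s | O.nestedKnowledge N P h.succ r s} t

/-- `P` solves `O`: in every run, each response is performed iff the trigger occurs, it is performed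
at most once, and it is performed no later than the next response. -/
structure OrderedResponse.SolvedBy (O : OrderedResponse Proc Input Act) (N : Network Proc)
    (P : Protocol Proc Input Act) : Prop where
  responds_iff : ∀ (r : Run N P) (h : Fin O.k), (∃ t, O.Responds r h t) ↔ ∃ t, O.Triggered r t
  once : ∀ (r : Run N P) (h : Fin O.k) (t t' : ℕ),
    O.Responds r h t → O.Responds r h t' → t = t'
  ordered : ∀ (r : Run N P) (h g : Fin O.k) (t t' : ℕ), (h : ℕ) + 1 = g →
    O.Responds r h t → O.Responds r g t' → t ≤ t'

end OrderedResponse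

end SyncNet

namespace SyncNet

section Distance

variable {Proc : Type*} {N : Network Proc}

/-! Under full information, agreement of two runs at a node propagates backwards: to earlier nodes
of the same process, to the sender of any message received there, hence along syncausal chains
(`agreeAt_of_syncausal`) and along bound guarantees (`agreeAt_of_guarantee`). The chain itself also
reappears in the second run.

Take a centipede ending at time `t'`. The leg from `θ h` makes the state of `i_h` at `t'` fix the
state at `θ h`, and with it the centipede's body up to `θ h` and the trigger at its start. So every
run that `i_h` cannot distinguish at `t'` contains the same truncated body, and induction on `h`
yields the nested knowledge (`nestedKnowledge_of_chain`). Non-hesitance turns its existence into a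
response. Since knowledge is veridical, deeper nesting implies shallower nesting
(`nestedKnowledge_anti`), which gives both the order of the responses and the occurrence of the
trigger. -/

theorem Network.Guarantee.exists_path {a b : Node Proc} (h : N.Guarantee a b) :
    ∃ w, N.Path a.1 b.1 w ∧ a.2 + w ≤ b.2 := by
  by_contra! hc
  -- The lower bound also covers the case of no path. Truncated subtraction is harmless: adding
  -- `a.2` back gives at least `b.2 + 1`.
  have hle : ((b.2 + 1 - a.2 : ℕ) : ℕ∞) ≤ N.dist a.1 b.1 := by
    refine le_iInf₂ fun w hw => ?_
    have := hc w hw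
    exact_mod_cast (by omega : b.2 + 1 - a.2 ≤ w)
  have hlt : ((a.2 + (b.2 + 1 - a.2) : ℕ) : ℕ∞) ≤ (b.2 : ℕ∞) := by
    push_cast
    exact (add_le_add_right (by exact_mod_cast hle) _).trans h
  have := Nat.cast_le.mp hlt
  omega

theorem Network.guarantee_refl (a : Node Proc) : N.Guarantee a a := by
  have h : N.dist a.1 a.1 ≤ ((0 : ℕ) : ℕ∞) := iInf₂_le 0 (Network.Path.nil a.1)
  calc (a.2 : ℕ∞) + N.dist a.1 a.1 ≤ a.2 + ((0 : ℕ) : ℕ∞) := add_le_add_right h _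
    _ = a.2 := by simp

end Distance

section Agreement

variable {Proc Input Act : Type*} {N : Network Proc} {P : Protocol Proc Input Act}

/-- The runs `r` and `r'` give the process of the node `a` the same local state at `a`. -/
def Run.AgreeAt (r r' : Run N P) (a : Node Proc) : Prop :=
  r'.localState a.1 a.2 = r.localState a.1 a.2

variable {r r' : Run N P} {i j : Proc} {s t : ℕ}

theorem FullInformation.history_eq (hfip : FullInformation N P) (h : r.AgreeAt r' (i, t)) :
    r'.history i t = r.history i t := by
  obtain ⟨read, hread⟩ := hfip.2 i
  rw [← hread, ← hread]
  exact congrArg read h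

theorem FullInformation.init_eq (hfip : FullInformation N P) (h : r.AgreeAt r' (i, t)) :
    r'.init i = r.init i :=
  congrArg Prod.fst (hfip.history_eq h)

theorem FullInformation.received_inputs_eq (hfip : FullInformation N P)
    (h : r.AgreeAt r' (i, t)) (hst : s ≤ t) :
    r'.received N i s = r.received N i s ∧ r'.inputs i s = r.inputs i s := by
  have hl := congrArg (fun p => p.2.1) (hfip.history_eq h)
  have hs := List.map_inj_left.mp hl s (List.mem_range.mpr (by omega))
  simpa using hs

/-- In a full-information protocol a local state determines the earlier ones. -/
theorem FullInformation.agreeAt_of_le (hfip : FullInformation N P)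
    (h : r.AgreeAt r' (i, t)) (hst : s ≤ t) : r.AgreeAt r' (i, s) := by
  -- Forward replay: the initial memory, and the messages and inputs up to `s`, are read off the
  -- later history and fed through `start` and `next`.
  induction s with
  | zero =>
    have hi := (hfip.received_inputs_eq h hst).2
    simp only [Run.AgreeAt, Execution.localState, r.mem_zero, r'.mem_zero, hi, hfip.init_eq h]
  | succ s ih =>
    obtain ⟨hr, hi⟩ := hfip.received_inputs_eq h hst
    have hs : r'.localState i s = r.localState i s := ih (by omega)
    simp only [Run.AgreeAt]
    unfold Execution.localState
    rw [r.mem_succ, r'.mem_succ, hr, hi, hs]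

theorem Run.chan_of_sent_isSome (h : (r.sent N i j s).isSome) : N.Chan i j := by
  by_contra hc
  simp [Execution.sent, hc] at h

theorem Run.mem_received {m : P.Msg} :
    m ∈ r.received N j t i ↔ ∃ s < t, r.delivery i j s = t ∧ r.sent N i j s = some m := by
  simp [Execution.received, and_assoc]

/-- In a full-information protocol the local state of a receiver determines the local state of the
sender and the transmission time. -/
theorem FullInformation.agreeAt_sender (hfip : FullInformation N P) (hc : N.Chan i j)
    (h : r.AgreeAt r' (j, r.delivery i j s)) :
    r.AgreeAt r' (i, s) ∧ r'.delivery i j s = r.delivery i j s := by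
  have hrec := (hfip.received_inputs_eq h le_rfl).1
  obtain ⟨⟨enc, hinj, henc⟩, -⟩ := hfip
  have hm : enc i (r.localState i s) ∈ r.received N j (r.delivery i j s) i :=
    Run.mem_received.mpr ⟨s, r.delivery_gt i j s hc, rfl, henc r i j s hc⟩
  rw [← hrec] at hm
  obtain ⟨s', -, hd, hs'⟩ := Run.mem_received.mp hm
  rw [henc r' i j s' hc, Option.some_inj] at hs'
  have hst := hinj i hs'
  -- The encoded state contains the clock, so the message reveals when it was sent.
  obtain rfl : s' = s := congrArg Prod.fst hst
  exact ⟨hst, hd⟩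

theorem FullInformation.agreeAt_of_syncausal (hfip : FullInformation N P) {a b : Node Proc}
    (hab : r.Syncausal a b) (h : r.AgreeAt r' b) : r.AgreeAt r' a ∧ r'.Syncausal a b := by
  induction hab with
  | local_prec ht => exact ⟨hfip.agreeAt_of_le h ht, .local_prec ht⟩
  | @message i j t hs =>
    have hc := Run.chan_of_sent_isSome hs
    obtain ⟨ha, hd⟩ := hfip.agreeAt_sender hc h
    obtain ⟨enc, -, henc⟩ := hfip.1
    refine ⟨ha, ?_⟩
    rw [← hd]
    exact .message (by simp [henc r' i j t hc])
  -- Vacuous: under full information no channel is ever silent.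
  | @timeout i j t hc hs =>
    obtain ⟨enc, -, henc⟩ := hfip.1
    simp [henc r i j t hc] at hs
  | trans _ _ ih₁ ih₂ =>
    obtain ⟨hb, hbc⟩ := ih₂ h
    obtain ⟨ha, hab⟩ := ih₁ hb
    exact ⟨ha, hab.trans hbc⟩

theorem FullInformation.agreeAt_of_path (hfip : FullInformation N P) {w : ℕ}
    (hp : N.Path i j w) (h : r.AgreeAt r' (j, t)) (hst : s + w ≤ t) : r.AgreeAt r' (i, s) := by
  induction hp generalizing s with
  | nil => exact hfip.agreeAt_of_le h hst
  | @cons i l j w hc _ ih =>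
    -- Whatever the actual delay on the first channel, arrival by `s + bound` leaves enough time for
    -- the rest of the path.
    have := r.delivery_le i l s hc
    exact (hfip.agreeAt_sender hc (ih h (by omega))).1

theorem FullInformation.agreeAt_of_guarantee (hfip : FullInformation N P) {a b : Node Proc}
    (hab : N.Guarantee a b) (h : r.AgreeAt r' b) : r.AgreeAt r' a := by
  obtain ⟨w, hp, hw⟩ := hab.exists_path
  exact hfip.agreeAt_of_path hp h hw

theorem Knows.holds {φ : Fact N P} (h : Knows i φ r t) : φ r t := h r t rfl

theorem Run.syncausal_of_chain {k : ℕ} {θ : Fin (k + 1) → Node Proc} {h : Fin (k + 1)}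
    (hbody : ∀ g : Fin k, g.succ ≤ h → r.Syncausal (θ g.castSucc) (θ g.succ)) :
    r.Syncausal (θ 0) (θ h) := by
  induction h using Fin.induction with
  | zero => exact .local_prec le_rfl
  | succ g ih =>
    exact (ih fun f hf => hbody f (hf.trans g.castSucc_lt_succ.le)).trans (hbody g le_rfl)

theorem FullInformation.syncausal_of_chain_of_agreeAt (hfip : FullInformation N P) {k : ℕ}
    {θ : Fin (k + 1) → Node Proc} {h : Fin (k + 1)}
    (hbody : ∀ g : Fin k, g.succ ≤ h → r.Syncausal (θ g.castSucc) (θ g.succ))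
    (ha : r.AgreeAt r' (θ h)) (g : Fin k) (hg : g.succ ≤ h) :
    r'.Syncausal (θ g.castSucc) (θ g.succ) := by
  induction h using Fin.induction with
  | zero => exact absurd hg (by simp)
  | succ f ih =>
    obtain ⟨hf, hs⟩ := hfip.agreeAt_of_syncausal (hbody f le_rfl) ha
    rcases hg.eq_or_lt with he | hlt
    · rwa [Fin.succ_injective _ he]
    · exact ih (fun f' hf' => hbody f' (hf'.trans f.castSucc_lt_succ.le)) hf
        (Fin.le_castSucc_iff.mpr hlt)

end Agreement

section OrderedResponse

variable {Proc Input Act : Type*} {N : Network Proc} {P : Protocol Proc Input Act}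
  {O : OrderedResponse Proc Input Act} {r : Run N P} {t t' : ℕ}

theorem OrderedResponse.nestedKnowledge_succ (h : Fin O.k) :
    O.nestedKnowledge N P h.succ = Knows (O.site h.succ) (O.nestedKnowledge N P h.castSucc) := by
  simp [OrderedResponse.nestedKnowledge, Fin.induction_succ]

theorem OrderedResponse.nestedKnowledge_anti {g h : Fin (O.k + 1)} (hgh : g ≤ h)
    (hk : O.nestedKnowledge N P h r t) : O.nestedKnowledge N P g r t := by
  induction h using Fin.induction with
  | zero => rwa [Fin.le_zero_iff.mp hgh]
  | succ f ih =>
    rcases hgh.eq_or_lt with rfl | hlt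
    · exact hk
    · rw [OrderedResponse.nestedKnowledge_succ] at hk
      exact ih (Fin.le_castSucc_iff.mpr hlt) hk.holds

/-- Stated for a truncated body with all legs ending at the common time `t'`, so that the induction
can pass to another run `r'`: legs depend only on the network, and the shorter body is transferred
by agreement at `θ g.succ`. -/
theorem FullInformation.nestedKnowledge_of_chain (hfip : FullInformation N P)
    {θ : Fin (O.k + 1) → Node Proc} (hθ : θ 0 = (O.site 0, t)) (htt' : t ≤ t')
    {h : Fin (O.k + 1)}
    (hbody : ∀ g : Fin O.k, g.succ ≤ h → r.Syncausal (θ g.castSucc) (θ g.succ))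
    (hlegs : ∀ g, g ≠ 0 → g ≤ h → N.Guarantee (θ g) (O.site g, t'))
    (htrig : O.Triggered r t) : O.nestedKnowledge N P h r t' := by
  induction h using Fin.induction generalizing r with
  | zero => exact ⟨t, htt', htrig⟩
  | succ g ih =>
    rw [OrderedResponse.nestedKnowledge_succ]
    intro r' t'' heq
    obtain rfl : t'' = t' := congrArg Prod.fst heq
    have hle := g.castSucc_lt_succ.le
    have ha : r.AgreeAt r' (θ g.succ) :=
      hfip.agreeAt_of_guarantee (hlegs g.succ g.succ_ne_zero le_rfl) heq
    have h0 : r.AgreeAt r' (O.site 0, t) :=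
      hθ ▸ (hfip.agreeAt_of_syncausal (Run.syncausal_of_chain hbody) ha).1
    refine ih (fun f hf => hfip.syncausal_of_chain_of_agreeAt hbody ha f (hf.trans hle))
      (fun f h0 hf => hlegs f h0 (hf.trans hle)) ?_
    have hin := (hfip.received_inputs_eq h0 le_rfl).2
    simpa only [OrderedResponse.Triggered, Run.Occurs, hin] using htrig

theorem FullInformation.nestedKnowledge_of_isCentipede (hfip : FullInformation N P)
    {θ : Fin (O.k + 1) → Node Proc} (hθ : r.IsCentipede O.site t t' θ)
    (htrig : O.Triggered r t) : O.nestedKnowledge N P (Fin.last O.k) r t' := by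
  refine hfip.nestedKnowledge_of_chain hθ.first hθ.le (fun g _ => hθ.body g) (fun g h0 _ => ?_)
    htrig
  by_cases hg : g = Fin.last O.k
  -- The final node has no leg in a centipede; it is its own endpoint at `t'`.
  · rw [hg, hθ.last]
    exact N.guarantee_refl _
  · exact hθ.legs g h0 hg

end OrderedResponse

end SyncNet

theorem mainTheorem6 {Proc Input Act : Type*} (N : SyncNet.Network Proc)
    (P : SyncNet.Protocol Proc Input Act) (O : SyncNet.OrderedResponse Proc Input Act)
    (hfip : SyncNet.FullInformation N P) (hnh : O.NonHesitant N P)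
    (hcent : ∀ (r : SyncNet.Run N P) (t : ℕ), O.Triggered r t →
      ∃ (t' : ℕ) (θ : Fin (O.k + 1) → SyncNet.Node Proc), r.IsCentipede O.site t t' θ) :
    O.SolvedBy N P := by
  classical
  refine ⟨fun r h => ⟨?_, ?_⟩, fun r h t t' ht ht' => ?_, fun r h g t t' hhg ht ht' => ?_⟩
  · rintro ⟨t, ht⟩
    have hk := ((hnh r h t).mp ht).1
    obtain ⟨s, -, hs⟩ :=
      SyncNet.OrderedResponse.nestedKnowledge_anti (Fin.zero_le h.succ) hk
    exact ⟨s, hs⟩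
  · rintro ⟨t, ht⟩
    obtain ⟨t', θ, hθ⟩ := hcent r t ht
    have hex : ∃ s, O.nestedKnowledge N P h.succ r s :=
      ⟨t', SyncNet.OrderedResponse.nestedKnowledge_anti (Fin.le_last _)
        (hfip.nestedKnowledge_of_isCentipede hθ ht)⟩
    exact ⟨Nat.find hex, (hnh r h _).mpr
      ⟨Nat.find_spec hex, fun _ hs => Nat.find_min' hex hs⟩⟩
  · exact ((hnh r h t).mp ht).unique ((hnh r h t').mp ht')
  · have hle : h.succ ≤ g.succ := Fin.succ_le_succ_iff.mpr (Fin.le_def.mpr (by omega))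
    -- `t` is the least time of the shallower knowledge, which already holds at `t'`.
    exact ((hnh r h t).mp ht).2
      (SyncNet.OrderedResponse.nestedKnowledge_anti hle ((hnh r g t').mp ht').1)
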